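/- Let $B,\sigma>0$. A two-armed bandit model is a pair $\nu=(\nu_1,\nu_2)$ of probability distributions on $\mathbb R$ with means $\mu_1,\mu_2\in[0,B]$ that are $\sigma$-sub-Gaussian, i.e. $\mathbb E_{\nu_a}[e^{t(X-\mu_a)}]\le e^{\sigma^2t^2/2}$ for all $t\in\mathbb R$. Let $\mathcal M$ be the class of all such models and $\mathcal M_\Delta\subset\mathcal M$ the class of those with gap $|\mu_1-\mu_2|=\Delta$. For a policy $\pi$ that takes $\tau$ samples in total and then recommends an arm $\hat I$, and a cost $c>0$ per sample, put $$R_2(\pi,\nu)=\mathbb E_{\nu,\pi}\big[\max(\mu_1,\mu_2)-\mu_{\hat I}+c\,\tau\big].$$ The racing policy $\pi$ with parameters $N^*,\delta$ proceeds in epochs $n=1,2,\dots$ In each epoch it takes one sample from each arm; let $\hat\mu_a(n)$ be the average of the first $n$ samples of arm $a$. It stops after the first epoch $n\ge 1$ such that $n>N^*$ or $|\hat\mu_1(n)-\hat\mu_2(n)|>\sqrt{4\sigma^2n^{-1}\log(2n/\delta)}$ (the root of a negative number being read as $0$), and recommends the arm with the larger $\hat\mu_a(n)$, with ties broken by a fair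 coin. All samples and the coin are independent. Take $$N^*=\frac{3}{2e}\Big(\frac{\sigma}{c}\Big)^{2/3},\qquad \delta=\frac{c}{B+2cN^*},$$ and put $$h_2(\Delta)=\begin{cases}\dfrac{\sigma^2c}{4\Delta^2}\log\Big(\dfrac{e\Delta^3}{\sigma^2c}\Big)&\text{if }\Delta\ge(\sigma^2c)^{1/3},\\[2mm] \Delta/4&\text{if }\Delta<(\sigma^2c)^{1/3},\end{cases}\qquad h_2^*=\frac38\Big(\frac{\sigma^2c}{e}\Big)^{1/3}.$$ Then, for every $c>0$ (a supremum over an empty class being $0$): 1. If $\Delta\ge(\sigma^2c)^{1/3}$, then $$\sup_{\nu\in\mathcal M_\Delta}R_2(\pi,\nu)\le128\,\max\Big\{0,\log\Big(\frac{3B\sigma^{2/3}}{c^{5/3}}\Big)\Big\}\,h_2(\Delta)+3c,$$ and if moreover $c^{5/3}\le 3B\min\{\sigma^{4/3},\sigma^2\}$, then also $$\sup_{\nu\in\mathcal M_\Delta}R_2(\pi,\nu)\le128\,\log\Big(\frac{3B\sigma^{4/3}}{c^{5/3}}\Big)\,h_2(\Delta)+3c.$$ 2. If $0\le\Delta<(\sigma^2c)^{1/3}$,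 then $$\sup_{\nu\in\mathcal M_\Delta}R_2(\pi,\nu)\le4h_2(\Delta)+2(\sigma^2c)^{1/3}+3c.$$ 3. $\displaystyle\sup_{\nu\in\mathcal M}R_2(\pi,\nu)\le9h_2^*+3c.$ Moreover, there are $C,c_0>0$ depending only on $B$ and $\sigma$ such that, for all $0<c\le c_0$, the supremum is at most $C\log(1/c)\,h_2(\Delta)$ for every $\Delta$ as in 1, at most $C\,(h_2(\Delta)+c^{1/3})$ for every $\Delta$ as in 2, and at most $C\,h_2^*$ in 3. -/

import Mathlib

open MeasureTheory ProbabilityTheory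
open scoped ENNReal NNReal

noncomputable section

namespace TwoArmRacing

/-- The mean of a reward distribution. -/
def mean (P : ProbabilityMeasure ℝ) : ℝ := ∫ x, x ∂(P : Measure ℝ)

/-- The `σ`-sub-Gaussian distributions: `E exp (t (X - E X)) ≤ exp (σ² t² / 2)` for every real `t`
(Mathlib's predicate includes the integrability of `exp (t (X - E X))`, and so that of `X`). -/
def subGaussian (σ : ℝ) : Set (ProbabilityMeasure ℝ) :=
  {P | HasSubgaussianMGF (fun x : ℝ => x - mean P) (σ ^ 2).toNNReal (P : Measure ℝ)}

/-- The class of two-armed bandit models with `σ`-sub-Gaussian arms whose means lie in `[0, B]`. -/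
def models (σ B : ℝ) : Set (Fin 2 → ProbabilityMeasure ℝ) :=
  {ν | ∀ a, ν a ∈ subGaussian σ ∧ mean (ν a) ∈ Set.Icc 0 B}

/-- The models with gap `Δ`. Either of the two arms may be the better one. -/
def modelsGap (σ B Δ : ℝ) : Set (Fin 2 → ProbabilityMeasure ℝ) :=
  {ν | ν ∈ models σ B ∧ |mean (ν 0) - mean (ν 1)| = Δ}

/-- A table of rewards: `Y s a` is the `(s + 1)`-st observation of arm `a`. -/
abbrev Rewards : Type := ℕ → Fin 2 → ℝ

/-- The randomness of an interaction: the rewards and the coin that breaks ties. -/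
abbrev Outcome : Type := Rewards × Fin 2

/-- The fair coin. -/
def coin : Measure (Fin 2) := (PMF.uniformOfFintype (Fin 2)).toMeasure

/-- The law of the interaction with the model `ν`: all rewards are independent, those of arm `a`
have law `ν a`, and the coin is fair and independent of the rewards. -/
def law (ν : Fin 2 → ProbabilityMeasure ℝ) : Measure Outcome :=
  (Measure.infinitePi (fun _ : ℕ => Measure.pi (fun a : Fin 2 => (ν a : Measure ℝ)))).prod coin

/-- The empirical mean of arm `a` after `n` observations of it. -/
def empMean (Y : Rewards) (a : Fin 2) (n : ℕ) : ℝ :=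
  (∑ s ∈ Finset.range n, Y s a) / n

/-- The width `e_n` of the confidence bound for two arms. -/
def confWidth (σ δ : ℝ) (n : ℕ) : ℝ :=
  √(4 * σ ^ 2 * (n : ℝ)⁻¹ * Real.log (2 * n / δ))

/-- After epoch `n` the arm with the smaller empirical mean is eliminated. -/
def Separated (σ δ : ℝ) (Y : Rewards) (n : ℕ) : Prop :=
  confWidth σ δ n < |empMean Y 0 n - empMean Y 1 n|

/-- The number of epochs that the racing policy runs. In each epoch it observes both arms once, and
a further epoch follows epoch `n` as long as `n ≤ N` and no arm is eliminated. (The set is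
nonempty: it contains every `n > N`.) -/
def stopEpoch (σ N δ : ℝ) (Y : Rewards) : ℕ :=
  sInf {n : ℕ | 1 ≤ n ∧ (N < n ∨ Separated σ δ Y n)}

/-- The total number of samples of the racing policy. -/
def racingTime (σ N δ : ℝ) (ω : Outcome) : ℕ :=
  2 * stopEpoch σ N δ ω.1

/-- The recommendation of the racing policy: the arm with the larger empirical mean when it stops,
with ties broken by the coin. -/
def racingArm (σ N δ : ℝ) (ω : Outcome) : Fin 2 :=
  let n := stopEpoch σ N δ ω.1
  if empMean ω.1 1 n < empMean ω.1 0 n then 0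
  else if empMean ω.1 0 n < empMean ω.1 1 n then 1
  else ω.2

/-- The risk `E [(simple regret) + c * (number of samples)]` under the model `ν` of a policy that
takes `τ` samples and recommends the arm `I`. -/
def risk₂ (c : ℝ) (τ : Outcome → ℕ) (I : Outcome → Fin 2) (ν : Fin 2 → ProbabilityMeasure ℝ) :
    ℝ≥0∞ :=
  ∫⁻ ω, ENNReal.ofReal
    ((max (mean (ν 0)) (mean (ν 1)) - mean (ν (I ω))) + c * (τ ω : ℝ)) ∂(law ν)

/-- The budget `N* = (3 / 2e) (σ / c) ^ (2 / 3)`. -/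
def budget (σ c : ℝ) : ℝ := 3 / (2 * Real.exp 1) * (σ / c) ^ (2 / 3 : ℝ)

/-- The confidence parameter `δ = c / (B + 2 c N*)`. -/
def confidence (B σ c : ℝ) : ℝ := c * (B + 2 * c * budget σ c)⁻¹

/-- The risk of the racing policy with the above parameters. -/
def racingRisk (B σ c : ℝ) (ν : Fin 2 → ProbabilityMeasure ℝ) : ℝ≥0∞ :=
  risk₂ c (racingTime σ (budget σ c) (confidence B σ c))
    (racingArm σ (budget σ c) (confidence B σ c)) ν

/-- The worst-case risk of the racing policy over a class `S` of models. -/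
def worstRisk (B σ c : ℝ) (S : Set (Fin 2 → ProbabilityMeasure ℝ)) : ℝ≥0∞ :=
  ⨆ ν ∈ S, racingRisk B σ c ν

/-- The gap-dependent hardness `h₂(Δ)`. -/
def hard₂ (σ c Δ : ℝ) : ℝ :=
  if (σ ^ 2 * c) ^ (1 / 3 : ℝ) ≤ Δ then
    σ ^ 2 * c / (4 * Δ ^ 2) * Real.log (Real.exp 1 * Δ ^ 3 / (σ ^ 2 * c))
  else Δ / 4

/-- The minimax hardness `h₂*`. -/
def hard₂Star (σ c : ℝ) : ℝ := 3 / 8 * (σ ^ 2 * c / Real.exp 1) ^ (1 / 3 : ℝ)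

end TwoArmRacing

end

/-! The risk is `2c` times the expected number of epochs plus the gap `Δ` times the probability of a
wrong recommendation. The reward difference within one epoch is sub-Gaussian with variance proxy
`2σ²`, so the difference of the empirical means after `n` epochs falls short of its mean by `ε` with
probability at most `exp(-nε²/(4σ²))` (`law_empMean_diff_le`). For `ε` equal to the confidence width
this is `δ/(2n)`.

On each path the number of epochs is at most `k` plus the number of later epochs within the budget
at which the better arm is not clearly ahead, and a wrong recommendation needs a wrong elimination
within the budget or a bad comparison at its end. Integrating gives `risk₂_racing_le_sum`; inserting
the tail bounds gives `risk₂_racing_le`.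

With `σ = c r³` the critical gap is `c r²` and the budget is `3r²/(2e)`. For a large gap, `k` is the
epoch from which the width is at most `Δ/2`, of order `(σ²/Δ²) log(2N/δ)`; the final error `Δ
exp(-NΔ²/(4σ²))` is at most `8cσ²/Δ²` by the choice of `N`. For a small gap, paying the whole budget
and losing `Δ` suffices. The minimax bound pays the whole budget and maximizes the final error over
`Δ`. -/

namespace TwoArmRacing

/-! ### Concentration of the empirical means -/

/-- The deviation of the difference of the two rewards of epoch `s` from its expectation. -/
theorem hasSubgaussianMGF_reward_diff {σ B : ℝ} {ν : Fin 2 → ProbabilityMeasure ℝ}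
    (hν : ν ∈ models σ B) {a b : Fin 2} (hab : a ≠ b) (s : ℕ) :
    HasSubgaussianMGF (fun Y : Rewards => (Y s b - mean (ν b)) - (Y s a - mean (ν a)))
      ((σ ^ 2).toNNReal + (σ ^ 2).toNNReal)
      (Measure.infinitePi (fun _ : ℕ => Measure.pi (fun a : Fin 2 => (ν a : Measure ℝ)))) := by
  have hpi : HasSubgaussianMGF
      (fun y : Fin 2 → ℝ => (y b - mean (ν b)) - (y a - mean (ν a)))
      ((σ ^ 2).toNNReal + (σ ^ 2).toNNReal) (Measure.pi (fun a : Fin 2 => (ν a : Measure ℝ))) := by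
    have hcoord (i : Fin 2) : HasSubgaussianMGF (fun y : Fin 2 → ℝ => y i - mean (ν i))
        (σ ^ 2).toNNReal (Measure.pi (fun a : Fin 2 => (ν a : Measure ℝ))) := by
      have hmp := measurePreserving_eval (fun a : Fin 2 => (ν a : Measure ℝ)) i
      refine HasSubgaussianMGF.of_map (Y := Function.eval i)
        (X := fun x : ℝ => x - mean (ν i)) hmp.measurable.aemeasurable ?_
      rw [hmp.map_eq]
      exact (hν i).1
    refine (hcoord b).sub_of_indepFun (hcoord a) ?_
    have := iIndepFun_pi (μ := fun a : Fin 2 => (ν a : Measure ℝ))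
      (X := fun i x => x - mean (ν i)) (fun i => by fun_prop)
    exact this.indepFun hab.symm
  have hmp := measurePreserving_eval_infinitePi
    (fun _ : ℕ => Measure.pi (fun a : Fin 2 => (ν a : Measure ℝ))) s
  refine HasSubgaussianMGF.of_map (Y := Function.eval s)
    (X := fun y : Fin 2 → ℝ => (y b - mean (ν b)) - (y a - mean (ν a)))
    hmp.measurable.aemeasurable ?_
  rw [hmp.map_eq]
  exact hpi

instance (ν : Fin 2 → ProbabilityMeasure ℝ) : IsProbabilityMeasure (law ν) := by
  unfold law coin
  infer_instance

@[fun_prop]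
theorem measurable_empMean (a : Fin 2) (n : ℕ) : Measurable fun ω : Outcome => empMean ω.1 a n := by
  unfold empMean
  fun_prop

/-- Hoeffding's inequality for the difference of the empirical means. -/
theorem law_empMean_diff_le {σ B : ℝ} {ν : Fin 2 → ProbabilityMeasure ℝ}
    (hν : ν ∈ models σ B) {a b : Fin 2} (hab : a ≠ b) {n : ℕ} (hn : 1 ≤ n) {ε : ℝ} (hε : 0 ≤ ε) :
    (law ν).real {ω | empMean ω.1 a n - empMean ω.1 b n ≤ mean (ν a) - mean (ν b) - ε} ≤
      Real.exp (-(n * ε ^ 2 / (4 * σ ^ 2))) := by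
  have hn0 : (0 : ℝ) < n := by exact_mod_cast hn
  set P := Measure.infinitePi (fun _ : ℕ => Measure.pi (fun a : Fin 2 => (ν a : Measure ℝ)))
    with hP
  set S : Set Rewards :=
    {Y | n * ε ≤ ∑ s ∈ Finset.range n, ((Y s b - mean (ν b)) - (Y s a - mean (ν a)))} with hS
  have hset : {ω : Outcome | empMean ω.1 a n - empMean ω.1 b n ≤ mean (ν a) - mean (ν b) - ε} =
      S ×ˢ Set.univ := by
    ext ω
    simp only [Set.mem_ofPred_eq, Set.mem_prod, Set.mem_univ, and_true, hS, empMean,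
      Finset.sum_sub_distrib, Finset.sum_const, Finset.card_range, nsmul_eq_mul]
    rw [← sub_div, div_le_iff₀ hn0]
    constructor <;> intro h <;> linarith
  have hindep : iIndepFun (fun (s : ℕ) (Y : Rewards) =>
      (Y s b - mean (ν b)) - (Y s a - mean (ν a))) P :=
    iIndepFun_infinitePi (P := fun _ : ℕ => Measure.pi (fun a : Fin 2 => (ν a : Measure ℝ)))
      (X := fun _ y => (y b - mean (ν b)) - (y a - mean (ν a))) (fun _ => by fun_prop)
  have hreal := HasSubgaussianMGF.measure_sum_range_ge_le_of_iIndepFun hindep (n := n)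
    (fun s _ => hasSubgaussianMGF_reward_diff hν hab s) (ε := n * ε) (by positivity)
  have : IsProbabilityMeasure coin := by unfold coin; infer_instance
  rw [hset, law, measureReal_prod_prod, probReal_univ, mul_one]
  refine hreal.trans_eq ?_
  congr 1
  rw [NNReal.coe_add, Real.coe_toNNReal _ (sq_nonneg σ)]
  -- For `σ = 0` both exponents are divisions by zero, so both bounds read `1`.
  rcases eq_or_ne σ 0 with rfl | hσ
  · simp
  · field_simp
    ring

/-! ### Stopping and failure events on a single path -/

theorem stopEpoch_spec (σ N δ : ℝ) (Y : Rewards) :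
    1 ≤ stopEpoch σ N δ Y ∧ (N < stopEpoch σ N δ Y ∨ Separated σ δ Y (stopEpoch σ N δ Y)) :=
  Nat.sInf_mem (s := {n : ℕ | 1 ≤ n ∧ (N < n ∨ Separated σ δ Y n)})
    ⟨⌊N⌋₊ + 1, by omega, Or.inl (by exact_mod_cast Nat.lt_floor_add_one N)⟩

theorem stopEpoch_le (σ N δ : ℝ) (Y : Rewards) : stopEpoch σ N δ Y ≤ ⌊N⌋₊ + 1 :=
  Nat.sInf_le ⟨by omega, Or.inl (by exact_mod_cast Nat.lt_floor_add_one N)⟩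

theorem not_separated_of_lt_stopEpoch {σ N δ : ℝ} {Y : Rewards} {n : ℕ} (hn : 1 ≤ n)
    (h : n < stopEpoch σ N δ Y) : ¬ Separated σ δ Y n :=
  fun hs => Nat.notMem_of_lt_sInf h ⟨hn, Or.inr hs⟩

/-- The arm `i` is not ahead of the arm `j` after epoch `n` by more than the confidence width. -/
def notAhead (σ δ : ℝ) (i j : Fin 2) (n : ℕ) : Set Outcome :=
  {ω | empMean ω.1 i n - empMean ω.1 j n ≤ confWidth σ δ n}

/-- The arm `i` is eliminated in favour of the arm `j` by the confidence bound after epoch `n`. -/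
def eliminated (σ δ : ℝ) (i j : Fin 2) (n : ℕ) : Set Outcome :=
  {ω | empMean ω.1 i n - empMean ω.1 j n < -confWidth σ δ n}

/-- The arm `i` does not have the larger empirical mean after epoch `n`. -/
def notLeading (i j : Fin 2) (n : ℕ) : Set Outcome :=
  {ω | empMean ω.1 i n - empMean ω.1 j n ≤ 0}

theorem separated_iff {σ δ : ℝ} {Y : Rewards} {n : ℕ} {i j : Fin 2} (hij : i ≠ j) :
    Separated σ δ Y n ↔ confWidth σ δ n < |empMean Y i n - empMean Y j n| := by
  unfold Separated
  fin_cases i <;> fin_cases j <;> simp_all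
  rw [abs_sub_comm]

theorem confWidth_nonneg (σ δ : ℝ) (n : ℕ) : 0 ≤ confWidth σ δ n := Real.sqrt_nonneg _

/-- Every epoch from `k` on that precedes the stop is not separated, so it is counted by an
indicator. This turns the expected stopping epoch into a sum of probabilities at fixed epochs. -/
theorem stopEpoch_le_add_sum {σ N δ : ℝ} {i j : Fin 2} (hij : i ≠ j) {k : ℕ} (hk : 1 ≤ k)
    (ω : Outcome) :
    (stopEpoch σ N δ ω.1 : ℝ) ≤ k + ∑ n ∈ Finset.Ico k (⌊N⌋₊ + 1),
      (notAhead σ δ i j n).indicator 1 ω := by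
  set T := stopEpoch σ N δ ω.1 with hT
  have h1 : (T : ℝ) ≤ k + ∑ n ∈ Finset.Ico k T, (1 : ℝ) := by
    simp only [Finset.sum_const, Nat.card_Ico, nsmul_eq_mul, mul_one]
    exact_mod_cast (by omega : T ≤ k + (T - k))
  have h2 : ∑ n ∈ Finset.Ico k T, (1 : ℝ) ≤ ∑ n ∈ Finset.Ico k T,
      (notAhead σ δ i j n).indicator (1 : Outcome → ℝ) ω := by
    refine Finset.sum_le_sum fun n hn => ?_
    rw [Finset.mem_Ico] at hn
    have hs := not_separated_of_lt_stopEpoch (hk.trans hn.1) hn.2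
    rw [separated_iff hij, not_lt] at hs
    rw [Set.indicator_of_mem (show ω ∈ notAhead σ δ i j n from (le_abs_self _).trans hs)]
    rfl
  have h3 : ∑ n ∈ Finset.Ico k T, (notAhead σ δ i j n).indicator (1 : Outcome → ℝ) ω ≤
      ∑ n ∈ Finset.Ico k (⌊N⌋₊ + 1), (notAhead σ δ i j n).indicator (1 : Outcome → ℝ) ω := by
    refine Finset.sum_le_sum_of_subset_of_nonneg
      (Finset.Ico_subset_Ico_right (stopEpoch_le _ _ _ _)) fun n _ _ =>
      Set.indicator_nonneg (fun _ _ => zero_le_one) _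
  linarith

theorem empMean_le_of_racingArm_ne {σ N δ : ℝ} {i j : Fin 2} (hij : i ≠ j) {ω : Outcome}
    (h : racingArm σ N δ ω ≠ i) :
    empMean ω.1 i (stopEpoch σ N δ ω.1) ≤ empMean ω.1 j (stopEpoch σ N δ ω.1) := by
  by_contra! hlt
  apply h
  unfold racingArm
  fin_cases i <;> fin_cases j <;> simp_all [not_lt_of_gt]

/-- A stop within the budget must come from separation, and a wrong recommendation then has the
wrong sign; a stop at `⌊N⌋₊ + 1` only reveals that `i` does not lead strictly. This is a union bound
in indicator form. -/
theorem one_le_sum_of_racingArm_ne {σ N δ : ℝ} {i j : Fin 2} (hij : i ≠ j) {ω : Outcome}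
    (h : racingArm σ N δ ω ≠ i) :
    1 ≤ ∑ n ∈ Finset.Icc 1 ⌊N⌋₊, (eliminated σ δ i j n).indicator (1 : Outcome → ℝ) ω +
      (notLeading i j (⌊N⌋₊ + 1)).indicator 1 ω := by
  have hle := empMean_le_of_racingArm_ne hij h
  have hspec := stopEpoch_spec σ N δ ω.1
  have hT := stopEpoch_le σ N δ ω.1
  set T := stopEpoch σ N δ ω.1
  have hnn (S : Set Outcome) : 0 ≤ S.indicator (1 : Outcome → ℝ) ω :=
    Set.indicator_nonneg (fun _ _ => zero_le_one) _
  rcases hT.eq_or_lt with heq | hlt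
  · rw [← heq, Set.indicator_of_mem (show ω ∈ notLeading i j T from sub_nonpos.2 hle)]
    exact le_add_of_nonneg_left (Finset.sum_nonneg fun n _ => hnn _)
  · have hTN : T ≤ ⌊N⌋₊ := by omega
    have hTN' : ¬ N < T := by
      have := (Nat.le_floor_iff' (by omega)).1 hTN
      linarith
    have hsep := (separated_iff hij).1 (hspec.2.resolve_left hTN')
    rw [abs_of_nonpos (sub_nonpos.2 hle)] at hsep
    have hmem : ω ∈ eliminated σ δ i j T := lt_neg_of_lt_neg hsep
    have hsingle := Finset.single_le_sum (f := fun n =>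
      (eliminated σ δ i j n).indicator (1 : Outcome → ℝ) ω) (fun n _ => hnn _)
      (Finset.mem_Icc.2 ⟨hspec.1, hTN⟩)
    rw [show (eliminated σ δ i j T).indicator (1 : Outcome → ℝ) ω = 1 from
      Set.indicator_of_mem hmem _] at hsingle
    exact hsingle.trans (le_add_of_nonneg_right (hnn _))

theorem measurableSet_notAhead (σ δ : ℝ) (i j : Fin 2) (n : ℕ) :
    MeasurableSet (notAhead σ δ i j n) :=
  measurableSet_le (by fun_prop) measurable_const

theorem measurableSet_eliminated (σ δ : ℝ) (i j : Fin 2) (n : ℕ) :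
    MeasurableSet (eliminated σ δ i j n) :=
  measurableSet_lt (by fun_prop) measurable_const

theorem measurableSet_notLeading (i j : Fin 2) (n : ℕ) : MeasurableSet (notLeading i j n) :=
  measurableSet_le (by fun_prop) measurable_const

/-! ### From failure probabilities to the risk -/

/-- The risk of a racing policy in terms of the probabilities of its failures: the expected number
of epochs after epoch `k`, and the elimination of the better arm. -/
theorem risk₂_racing_le_sum {σ N δ c : ℝ} (hc : 0 ≤ c) (ν : Fin 2 → ProbabilityMeasure ℝ)
    {i j : Fin 2} (hij : i ≠ j) (hle : mean (ν j) ≤ mean (ν i)) {k : ℕ} (hk : 1 ≤ k) :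
    risk₂ c (racingTime σ N δ) (racingArm σ N δ) ν ≤ ENNReal.ofReal
      (2 * c * (k + ∑ n ∈ Finset.Ico k (⌊N⌋₊ + 1), (law ν).real (notAhead σ δ i j n)) +
        (mean (ν i) - mean (ν j)) *
          (∑ n ∈ Finset.Icc 1 ⌊N⌋₊, (law ν).real (eliminated σ δ i j n) +
            (law ν).real (notLeading i j (⌊N⌋₊ + 1)))) := by
  set Δ := mean (ν i) - mean (ν j) with hΔ
  have hΔ0 : 0 ≤ Δ := sub_nonneg.2 hle
  have hmax : max (mean (ν 0)) (mean (ν 1)) = mean (ν i) := by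
    fin_cases i <;> fin_cases j <;> simp_all
  set g : Outcome → ℝ := fun ω =>
    2 * c * (k + ∑ n ∈ Finset.Ico k (⌊N⌋₊ + 1), (notAhead σ δ i j n).indicator 1 ω) +
      Δ * (∑ n ∈ Finset.Icc 1 ⌊N⌋₊, (eliminated σ δ i j n).indicator 1 ω +
        (notLeading i j (⌊N⌋₊ + 1)).indicator 1 ω) with hg
  have hnn (S : Set Outcome) (ω : Outcome) : 0 ≤ S.indicator (1 : Outcome → ℝ) ω :=
    Set.indicator_nonneg (fun _ _ => zero_le_one) _
  have hg0 : ∀ ω, 0 ≤ g ω := fun ω => by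
    have h1 := Finset.sum_nonneg fun n (_ : n ∈ Finset.Ico k (⌊N⌋₊ + 1)) =>
      hnn (notAhead σ δ i j n) ω
    have h2 := Finset.sum_nonneg fun n (_ : n ∈ Finset.Icc 1 ⌊N⌋₊) =>
      hnn (eliminated σ δ i j n) ω
    have h3 := hnn (notLeading i j (⌊N⌋₊ + 1)) ω
    simp only [hg]
    positivity
  have hint {S : Set Outcome} (hS : MeasurableSet S) :
      Integrable (S.indicator (1 : Outcome → ℝ)) (law ν) :=
    (integrable_const (1 : ℝ)).indicator hS
  have hI1 := integrable_finsetSum (Finset.Ico k (⌊N⌋₊ + 1)) fun n _ =>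
    hint (measurableSet_notAhead σ δ i j n)
  have hI2 := integrable_finsetSum (Finset.Icc 1 ⌊N⌋₊) fun n _ =>
    hint (measurableSet_eliminated σ δ i j n)
  have hI3 := hint (measurableSet_notLeading i j (⌊N⌋₊ + 1))
  have hA : Integrable (fun ω => 2 * c * (k + ∑ n ∈ Finset.Ico k (⌊N⌋₊ + 1),
      (notAhead σ δ i j n).indicator (1 : Outcome → ℝ) ω)) (law ν) :=
    ((integrable_const (k : ℝ)).add hI1).const_mul (2 * c)
  have hB : Integrable (fun ω => Δ * (∑ n ∈ Finset.Icc 1 ⌊N⌋₊,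
      (eliminated σ δ i j n).indicator (1 : Outcome → ℝ) ω +
        (notLeading i j (⌊N⌋₊ + 1)).indicator 1 ω)) (law ν) :=
    (hI2.add hI3).const_mul Δ
  have hgint : Integrable g (law ν) := hA.add hB
  have hpt : ∀ ω, (max (mean (ν 0)) (mean (ν 1)) - mean (ν (racingArm σ N δ ω))) +
      c * (racingTime σ N δ ω : ℝ) ≤ g ω := fun ω => by
    have hT := stopEpoch_le_add_sum (σ := σ) (N := N) (δ := δ) hij hk ω
    have hR : mean (ν i) - mean (ν (racingArm σ N δ ω)) ≤
        Δ * (∑ n ∈ Finset.Icc 1 ⌊N⌋₊, (eliminated σ δ i j n).indicator 1 ω +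
          (notLeading i j (⌊N⌋₊ + 1)).indicator 1 ω) := by
      by_cases h : racingArm σ N δ ω = i
      · rw [h, sub_self]
        exact mul_nonneg hΔ0 (add_nonneg (Finset.sum_nonneg fun n _ => hnn _ ω) (hnn _ ω))
      · have hj : racingArm σ N δ ω = j := by
          omega
        rw [hj]
        exact le_mul_of_one_le_right hΔ0 (one_le_sum_of_racingArm_ne hij h)
    rw [hmax]
    have hmul := mul_le_mul_of_nonneg_left hT (by positivity : 0 ≤ 2 * c)
    simp only [hg, racingTime]
    push_cast
    linarith
  calc risk₂ c (racingTime σ N δ) (racingArm σ N δ) ν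
      ≤ ∫⁻ ω, ENNReal.ofReal (g ω) ∂(law ν) :=
        lintegral_mono fun ω => ENNReal.ofReal_le_ofReal (hpt ω)
    _ = ENNReal.ofReal (∫ ω, g ω ∂(law ν)) :=
        (ofReal_integral_eq_lintegral_ofReal hgint (Filter.Eventually.of_forall hg0)).symm
    _ = _ := by
        congr 1
        simp only [hg]
        rw [integral_add hA hB, integral_const_mul, integral_const_mul,
          integral_add (integrable_const _) hI1, integral_add hI2 hI3,
          integral_finsetSum _ fun n _ => hint (measurableSet_notAhead σ δ i j n),
          integral_finsetSum _ fun n _ => hint (measurableSet_eliminated σ δ i j n),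
          integral_indicator_one (measurableSet_notLeading _ _ _)]
        simp only [integral_indicator_one (measurableSet_notAhead _ _ _ _ _),
          integral_indicator_one (measurableSet_eliminated _ _ _ _ _)]
        simp

section failure

variable {σ B δ : ℝ} {ν : Fin 2 → ProbabilityMeasure ℝ} {i j : Fin 2} {n : ℕ}

/-- The width is calibrated to the Hoeffding exponent; `δ ≤ 2n` keeps the logarithm nonnegative, so
the square root is not truncated. -/
theorem exp_neg_confWidth_sq (hσ : 0 < σ) (hδ : 0 < δ) (hn : 1 ≤ n) (hδn : δ ≤ 2 * n) :
    Real.exp (-(n * confWidth σ δ n ^ 2 / (4 * σ ^ 2))) = δ / (2 * n) := by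
  have hn0 : (0 : ℝ) < n := by exact_mod_cast hn
  have hlog : 0 ≤ Real.log (2 * n / δ) := Real.log_nonneg (by rwa [le_div_iff₀ hδ, one_mul])
  have hexp : n * confWidth σ δ n ^ 2 / (4 * σ ^ 2) = Real.log (2 * n / δ) := by
    rw [confWidth, Real.sq_sqrt (by positivity)]
    field_simp
  rw [hexp, Real.exp_neg, Real.exp_log (by positivity), inv_div]

theorem law_notLeading_le (hν : ν ∈ models σ B) (hij : i ≠ j) (hle : mean (ν j) ≤ mean (ν i))
    (hn : 1 ≤ n) :
    (law ν).real (notLeading i j n) ≤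
      Real.exp (-(n * ((mean (ν i) - mean (ν j)) ^ 2 / (4 * σ ^ 2)))) := by
  have h := law_empMean_diff_le hν hij hn (sub_nonneg.2 hle)
  rw [sub_self, mul_div_assoc] at h
  exact h

/-- A wrong elimination is a deviation by `Δ + e_n`, and `(Δ + e_n)² ≥ Δ² + e_n²` splits the tail
into a product. The extra exponential factor later makes the sum over `n` bounded independently of
the budget. -/
theorem law_eliminated_le (hν : ν ∈ models σ B) (hij : i ≠ j) (hle : mean (ν j) ≤ mean (ν i))
    (hσ : 0 < σ) (hδ : 0 < δ) (hn : 1 ≤ n) (hδn : δ ≤ 2 * n) :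
    (law ν).real (eliminated σ δ i j n) ≤
      δ / (2 * n) * Real.exp (-(n * ((mean (ν i) - mean (ν j)) ^ 2 / (4 * σ ^ 2)))) := by
  have hΔ := sub_nonneg.2 hle
  have he := confWidth_nonneg σ δ n
  have h := law_empMean_diff_le hν hij hn (add_nonneg hΔ he)
  refine ((measureReal_mono ?_).trans h).trans ?_
  · intro ω hω
    have : empMean ω.1 i n - empMean ω.1 j n < -confWidth σ δ n := hω
    change empMean ω.1 i n - empMean ω.1 j n ≤ _
    linarith
  · rw [← exp_neg_confWidth_sq hσ hδ hn hδn, ← Real.exp_add, Real.exp_le_exp, ← neg_add,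
      neg_le_neg_iff, ← mul_div_assoc, ← add_div]
    gcongr
    nlinarith [mul_nonneg (Nat.cast_nonneg (α := ℝ) n) (mul_nonneg hΔ he)]

theorem law_notAhead_le (hν : ν ∈ models σ B) (hij : i ≠ j) (hσ : 0 < σ) (hδ : 0 < δ)
    (hn : 1 ≤ n) (hδn : δ ≤ 2 * n) (hsep : 2 * confWidth σ δ n ≤ mean (ν i) - mean (ν j)) :
    (law ν).real (notAhead σ δ i j n) ≤ δ / (2 * n) := by
  have he := confWidth_nonneg σ δ n
  refine ((measureReal_mono ?_).trans (law_empMean_diff_le hν hij hn he)).trans_eq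
    (exp_neg_confWidth_sq hσ hδ hn hδn)
  intro ω hω
  have : empMean ω.1 i n - empMean ω.1 j n ≤ confWidth σ δ n := hω
  change empMean ω.1 i n - empMean ω.1 j n ≤ _
  linarith

end failure

/-- The risk of a racing policy whose confidence width is at most half of the gap from epoch `k`
on. -/
theorem risk₂_racing_le {σ B N δ c : ℝ} (hc : 0 ≤ c) (hσ : 0 < σ) (hδ : 0 < δ)
    {ν : Fin 2 → ProbabilityMeasure ℝ} (hν : ν ∈ models σ B) {i j : Fin 2} (hij : i ≠ j)
    {Δ : ℝ} (hΔ : mean (ν i) - mean (ν j) = Δ) (hΔ0 : 0 ≤ Δ) {k : ℕ} (hk : 1 ≤ k)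
    (hδN : 1 ≤ ⌊N⌋₊ → δ ≤ 2) (hsep : ∀ n, k ≤ n → n ≤ ⌊N⌋₊ → 2 * confWidth σ δ n ≤ Δ) :
    risk₂ c (racingTime σ N δ) (racingArm σ N δ) ν ≤ ENNReal.ofReal
      (2 * c * (k + ∑ n ∈ Finset.Ico k (⌊N⌋₊ + 1), δ / (2 * n)) +
        Δ * (∑ n ∈ Finset.Icc 1 ⌊N⌋₊, δ / (2 * n) * Real.exp (-(n * (Δ ^ 2 / (4 * σ ^ 2)))) +
            Real.exp (-((⌊N⌋₊ + 1 : ℕ) * (Δ ^ 2 / (4 * σ ^ 2)))))) := by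
  have hle : mean (ν j) ≤ mean (ν i) := by linarith
  have hδn : ∀ n : ℕ, 1 ≤ n → n ≤ ⌊N⌋₊ → δ ≤ 2 * n := fun n h1 h2 => by
    have : (1 : ℝ) ≤ n := by exact_mod_cast h1
    linarith [hδN (h1.trans h2)]
  refine (risk₂_racing_le_sum hc ν hij hle hk).trans (ENNReal.ofReal_le_ofReal ?_)
  subst hΔ
  gcongr with n hn n hn
  · rw [Finset.mem_Ico] at hn
    exact law_notAhead_le hν hij hσ hδ (hk.trans hn.1) (hδn n (hk.trans hn.1) (by omega))
      (hsep n hn.1 (by omega))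
  · rw [Finset.mem_Icc] at hn
    exact law_eliminated_le hν hij hle hσ hδ hn.1 (hδn n hn.1 hn.2)
  · exact law_notLeading_le hν hij hle (by omega)

/-- The risk is at most the cost of the whole budget plus the gap. -/
theorem risk₂_racing_le_budget {σ N δ c : ℝ} (hc : 0 ≤ c) (hN : 0 ≤ N)
    {ν : Fin 2 → ProbabilityMeasure ℝ} {i j : Fin 2} (hij : i ≠ j)
    {Δ : ℝ} (hΔ : mean (ν i) - mean (ν j) = Δ) (hΔ0 : 0 ≤ Δ) :
    risk₂ c (racingTime σ N δ) (racingArm σ N δ) ν ≤ ENNReal.ofReal (2 * c * (N + 1) + Δ) := by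
  have hmax : max (mean (ν 0)) (mean (ν 1)) = mean (ν i) := by
    have hle : mean (ν j) ≤ mean (ν i) := by linarith
    fin_cases i <;> fin_cases j <;> simp_all
  have hpt : ∀ ω, (max (mean (ν 0)) (mean (ν 1)) - mean (ν (racingArm σ N δ ω))) +
      c * (racingTime σ N δ ω : ℝ) ≤ 2 * c * (N + 1) + Δ := fun ω => by
    have hT : (stopEpoch σ N δ ω.1 : ℝ) ≤ N + 1 := by
      have h1 : (stopEpoch σ N δ ω.1 : ℝ) ≤ ⌊N⌋₊ + 1 := by
        exact_mod_cast stopEpoch_le σ N δ ω.1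
      linarith [Nat.floor_le hN]
    have hR : mean (ν i) - mean (ν (racingArm σ N δ ω)) ≤ Δ := by
      by_cases h : racingArm σ N δ ω = i
      · rw [h, sub_self]
        exact hΔ0
      · have hj : racingArm σ N δ ω = j := by omega
        rw [hj, hΔ]
    have hmul := mul_le_mul_of_nonneg_left hT (by positivity : 0 ≤ 2 * c)
    rw [hmax, racingTime]
    push_cast
    linarith
  calc risk₂ c (racingTime σ N δ) (racingArm σ N δ) ν
      ≤ ∫⁻ _, ENNReal.ofReal (2 * c * (N + 1) + Δ) ∂(law ν) :=
        lintegral_mono fun ω => ENNReal.ofReal_le_ofReal (hpt ω)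
    _ = _ := by simp

/-! ### Elementary inequalities -/

theorem sq_mul_exp_neg_le {v : ℝ} (hv : 0 < v) (z : ℝ) :
    z ^ 2 * Real.exp (-(v * z ^ 2)) ≤ 1 / (Real.exp 1 * v) := by
  have h := Real.add_one_le_exp (v * z ^ 2 - 1)
  rw [sub_add_cancel, Real.exp_sub, le_div_iff₀ (Real.exp_pos 1)] at h
  rw [Real.exp_neg, ← div_eq_mul_inv, div_le_div_iff₀ (Real.exp_pos _) (by positivity)]
  linarith

/-- The square of `z³ exp(-vz²)` is the cube of `z² exp(-(2v/3)z²)`. Stating the hypothesis for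
squares avoids fractional powers. -/
theorem cube_mul_exp_neg_le {v z s : ℝ} (hv : 0 < v) (hs : 0 ≤ s)
    (h : (3 / (2 * Real.exp 1 * v)) ^ 3 ≤ s ^ 2) :
    z ^ 3 * Real.exp (-(v * z ^ 2)) ≤ s := by
  refine le_of_abs_le (abs_le_of_sq_le_sq ?_ hs)
  have h1 := sq_mul_exp_neg_le (by positivity : 0 < 2 * v / 3) z
  calc (z ^ 3 * Real.exp (-(v * z ^ 2))) ^ 2
      = (z ^ 2 * Real.exp (-(2 * v / 3 * z ^ 2))) ^ 3 := by
        rw [mul_pow, mul_pow, ← Real.exp_nat_mul, ← Real.exp_nat_mul]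
        ring_nf
    _ ≤ (1 / (Real.exp 1 * (2 * v / 3))) ^ 3 := by gcongr
    _ = (3 / (2 * Real.exp 1 * v)) ^ 3 := by
        congr 1
        field_simp
    _ ≤ s ^ 2 := h

theorem sum_Icc_inv_le (m : ℕ) : ∑ n ∈ Finset.Icc 1 m, (n : ℝ)⁻¹ ≤ ((m : ℝ) + 1) / 2 := by
  induction m with
  | zero => norm_num
  | succ m ih =>
    rw [Finset.sum_Icc_succ_top (by omega)]
    rcases m.eq_zero_or_pos with rfl | hm
    · norm_num
    · have : ((m + 1 : ℕ) : ℝ)⁻¹ ≤ 2⁻¹ := by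
        gcongr
        exact_mod_cast (by omega : 2 ≤ m + 1)
      push_cast at this ⊢
      linarith

theorem sum_Icc_inv_sq_le (m : ℕ) :
    ∑ n ∈ Finset.Icc 1 m, ((n : ℝ) ^ 2)⁻¹ ≤ 2 - (m : ℝ)⁻¹ := by
  induction m with
  | zero => norm_num
  | succ m ih =>
    rw [Finset.sum_Icc_succ_top (by omega)]
    rcases m.eq_zero_or_pos with rfl | hm
    · norm_num
    · have hm0 : (0 : ℝ) < m := by exact_mod_cast hm
      have h : (((m : ℝ) + 1) ^ 2)⁻¹ ≤ (m : ℝ)⁻¹ - ((m : ℝ) + 1)⁻¹ := by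
        rw [inv_sub_inv hm0.ne' (by positivity), inv_eq_one_div]
        gcongr <;> linarith
      push_cast
      linarith

theorem budget_eq {c r : ℝ} (hc : 0 < c) (hr : 0 < r) :
    budget (c * r ^ 3) c = 3 / (2 * Real.exp 1) * r ^ 2 := by
  rw [budget, mul_div_cancel_left₀ _ hc.ne', ← Real.rpow_natCast, ← Real.rpow_mul hr.le,
    ← Real.rpow_natCast]
  norm_num

/-! ### The policy with the tuned parameters -/

section policy

variable {B c r Δ : ℝ}

theorem confidence_eq (hc : 0 < c) (hr : 0 < r) :
    confidence B (c * r ^ 3) c = c / (B + 2 * c * (3 / (2 * Real.exp 1) * r ^ 2)) := by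
  rw [confidence, budget_eq hc hr]
  exact (div_eq_mul_inv _ _).symm

/-- The two summands of the denominator have separate tasks: `B` bounds the regret weight `Δδ`, and
`2cN` bounds the sum of `δ` over the budget. -/
theorem confidence_bounds (hB : 0 < B) (hc : 0 < c) (hΔB : Δ ≤ B) {N : ℝ} (hN : 0 < N) :
    0 < c / (B + 2 * c * N) ∧ Δ * (c / (B + 2 * c * N)) ≤ c ∧
      c / (B + 2 * c * N) * N ≤ 1 / 2 := by
  refine ⟨by positivity, ?_, ?_⟩
  · rw [mul_div_assoc', div_le_iff₀ (by positivity)]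
    nlinarith [mul_pos hc hN]
  · rw [div_mul_eq_mul_div, div_le_iff₀ (by positivity)]
    nlinarith

/-- The probability of a wrong elimination, weighted by the gap. -/
theorem sum_eliminated_le {δ a : ℝ} (hc : 0 ≤ c) (hδ : Δ * δ ≤ c) (m : ℕ)
    (ha : 0 < a) :
    Δ * ∑ n ∈ Finset.Icc 1 m, δ / (2 * n) * Real.exp (-(n * a)) ≤ c / a := by
  have hterm : ∀ n ∈ Finset.Icc 1 m, Δ * (δ / (2 * n) * Real.exp (-(n * a))) ≤
      c / (2 * a) * ((n : ℝ) ^ 2)⁻¹ := fun n hn => by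
    have hn0 : (0 : ℝ) < n := by exact_mod_cast (Finset.mem_Icc.1 hn).1
    -- This replaces the harmonic sum by a convergent series of `1/n²`.
    have hexp : Real.exp (-(n * a)) ≤ (n * a)⁻¹ := by
      rw [Real.exp_neg]
      gcongr
      linarith [Real.add_one_le_exp (n * a)]
    calc Δ * (δ / (2 * n) * Real.exp (-(n * a)))
        = Δ * δ * (Real.exp (-(n * a)) / (2 * n)) := by ring
      _ ≤ c * ((n * a)⁻¹ / (2 * n)) := by gcongr
      _ = c / (2 * a) * ((n : ℝ) ^ 2)⁻¹ := by
        field_simp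
  rw [Finset.mul_sum]
  refine (Finset.sum_le_sum hterm).trans ?_
  rw [← Finset.mul_sum]
  have h2 : ∑ n ∈ Finset.Icc 1 m, ((n : ℝ) ^ 2)⁻¹ ≤ 2 :=
    (sum_Icc_inv_sq_le m).trans (sub_le_self _ (by positivity))
  calc c / (2 * a) * ∑ n ∈ Finset.Icc 1 m, ((n : ℝ) ^ 2)⁻¹ ≤ c / (2 * a) * 2 := by gcongr
    _ = c / a := by field_simp

theorem racingRisk_le_minimax (hB : 0 < B) (hc : 0 < c) (hr : 0 < r) (hΔ0 : 0 ≤ Δ) (hΔB : Δ ≤ B)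
    {ν : Fin 2 → ProbabilityMeasure ℝ} (hν : ν ∈ models (c * r ^ 3) B) {i j : Fin 2} (hij : i ≠ j)
    (hΔ : mean (ν i) - mean (ν j) = Δ) :
    racingRisk B (c * r ^ 3) c ν ≤
      ENNReal.ofReal (27 / 8 * (c * r ^ 2 * Real.exp (-(1 / 3))) + 3 * c) := by
  have he1 := Real.exp_one_gt_d9
  have he2 := Real.exp_one_lt_d9
  have hbud := budget_eq hc hr
  have hconf := confidence_eq (B := B) hc hr
  rw [racingRisk, hbud, hconf]
  set κ := 3 / (2 * Real.exp 1) with hκ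
  have hκ0 : 0 < κ := by positivity
  have hκ1 : κ ≤ 0.552 := by
    rw [hκ, div_le_iff₀ (by positivity)]
    linarith
  set N := κ * r ^ 2 with hN
  have hN0 : 0 < N := by positivity
  set δ := c / (B + 2 * c * N) with hδ
  obtain ⟨hδ0, hδB, hδN⟩ : 0 < δ ∧ Δ * δ ≤ c ∧ δ * N ≤ 1 / 2 := confidence_bounds hB hc hΔB hN0
  have hm : (⌊N⌋₊ : ℝ) ≤ N := Nat.floor_le hN0.le
  have hmlt : N < (⌊N⌋₊ + 1 : ℕ) := by exact_mod_cast Nat.lt_floor_add_one N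
  -- With `k` past the budget the separation condition is vacuous: the whole budget is paid, and no
  -- lower bound on the gap is needed.
  refine (risk₂_racing_le hc.le (by positivity) hδ0 hν hij hΔ hΔ0 (k := ⌊N⌋₊ + 1) (by omega)
    (fun h => ?_) (fun n h1 h2 => by omega)).trans (ENNReal.ofReal_le_ofReal ?_)
  · have : (1 : ℝ) ≤ N := (Nat.one_le_floor_iff N).1 h
    nlinarith
  rw [Finset.Ico_self, Finset.sum_empty, mul_add Δ]
  have hsum : Δ * ∑ n ∈ Finset.Icc 1 ⌊N⌋₊,
      δ / (2 * n) * Real.exp (-(n * (Δ ^ 2 / (4 * (c * r ^ 3) ^ 2)))) ≤ c / 4 * (N + 1) := by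
    calc Δ * ∑ n ∈ Finset.Icc 1 ⌊N⌋₊,
          δ / (2 * n) * Real.exp (-(n * (Δ ^ 2 / (4 * (c * r ^ 3) ^ 2))))
        ≤ Δ * ∑ n ∈ Finset.Icc 1 ⌊N⌋₊, δ / (2 * n) := by
          gcongr with n hn
          exact mul_le_of_le_one_right (by positivity) (Real.exp_le_one_iff.2 (by
            rw [neg_nonpos]
            positivity))
      _ = Δ * δ / 2 * ∑ n ∈ Finset.Icc 1 ⌊N⌋₊, (n : ℝ)⁻¹ := by
          rw [Finset.mul_sum, Finset.mul_sum]
          refine Finset.sum_congr rfl fun n _ => ?_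
          field_simp
      _ ≤ c / 2 * ((N + 1) / 2) := by
          gcongr
          exact (sum_Icc_inv_le _).trans (by gcongr)
      _ = c / 4 * (N + 1) := by ring
  have hlast : Δ * Real.exp (-((⌊N⌋₊ + 1 : ℕ) * (Δ ^ 2 / (4 * (c * r ^ 3) ^ 2)))) ≤
      1.1548 * (c * r ^ 2) := by
    have hexp : Real.exp (-((⌊N⌋₊ + 1 : ℕ) * (Δ ^ 2 / (4 * (c * r ^ 3) ^ 2)))) ≤
        Real.exp (-(N * (Δ ^ 2 / (4 * (c * r ^ 3) ^ 2)))) := by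
      gcongr
    refine (mul_le_mul_of_nonneg_left hexp hΔ0).trans ?_
    refine le_of_abs_le (abs_le_of_sq_le_sq ?_ (by positivity))
    have h1 := sq_mul_exp_neg_le (by positivity : 0 < N / (2 * (c * r ^ 3) ^ 2)) Δ
    calc (Δ * Real.exp (-(N * (Δ ^ 2 / (4 * (c * r ^ 3) ^ 2))))) ^ 2
        = Δ ^ 2 * Real.exp (-(N / (2 * (c * r ^ 3) ^ 2) * Δ ^ 2)) := by
          rw [mul_pow, ← Real.exp_nat_mul]
          congr 2
          push_cast
          field_simp
          ring
      _ ≤ 1 / (Real.exp 1 * (N / (2 * (c * r ^ 3) ^ 2))) := h1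
      _ = 4 / 3 * (c * r ^ 2) ^ 2 := by
          rw [hN, hκ]
          field_simp
          ring
      _ ≤ (1.1548 * (c * r ^ 2)) ^ 2 := by
          rw [mul_pow 1.1548]
          have : (4 / 3 : ℝ) ≤ 1.1548 ^ 2 := by norm_num
          exact mul_le_mul_of_nonneg_right this (sq_nonneg _)
  have hroot : (0.714 : ℝ) ≤ Real.exp (-(1 / 3)) := by
    have h3 : Real.exp (1 / 3) ^ 3 = Real.exp 1 := by
      rw [← Real.exp_nat_mul]
      norm_num
    have h14 : Real.exp (1 / 3) ≤ 1.4 :=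
      le_of_pow_le_pow_left₀ three_ne_zero (by norm_num) (by rw [h3]; linarith)
    rw [Real.exp_neg, le_inv_comm₀ (by norm_num) (Real.exp_pos _)]
    exact h14.trans (by norm_num)
  have hcr : 0 < c * r ^ 2 := by positivity
  have hNr : c * N ≤ 0.552 * (c * r ^ 2) := by
    rw [hN, mul_left_comm]
    gcongr
  have h1 : 2 * c * (⌊N⌋₊ + 1 : ℕ) ≤ 2 * c * (N + 1) := by
    push_cast
    gcongr
  have h2 := mul_le_mul_of_nonneg_left hroot hcr.le
  -- In units of `c r²` the total is `2.25 · 0.552 + 1.1548 < 2.397`, against `27/8 · 0.714 >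
  -- 2.409`; the remaining `2.25c` fits into `3c`.
  nlinarith

theorem racingRisk_le_budget (hc : 0 < c) (hr : 0 < r) (hΔ0 : 0 ≤ Δ)
    {ν : Fin 2 → ProbabilityMeasure ℝ} {i j : Fin 2} (hij : i ≠ j)
    (hΔ : mean (ν i) - mean (ν j) = Δ) :
    racingRisk B (c * r ^ 3) c ν ≤ ENNReal.ofReal (2 * (c * r ^ 2) + 2 * c + Δ) := by
  have hbud := budget_eq hc hr
  have he := Real.exp_one_gt_d9
  have hκ : 3 / (2 * Real.exp 1) ≤ 1 := by
    rw [div_le_iff₀ (by positivity)]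
    linarith
  refine (risk₂_racing_le_budget hc.le (hbud ▸ by positivity) hij hΔ hΔ0).trans
    (ENNReal.ofReal_le_ofReal ?_)
  have h : c * (3 / (2 * Real.exp 1) * r ^ 2) ≤ c * (1 * r ^ 2) := by gcongr
  rw [hbud]
  linarith

/-- The gap-dependent bound when the budget does not allow a second epoch. -/
theorem racingRisk_le_of_budget_lt_one (hB : 0 < B) (hc : 0 < c) (hr : 0 < r)
    (hN : 3 / (2 * Real.exp 1) * r ^ 2 < 1) (hΔr : c * r ^ 2 ≤ Δ) (hΔB : Δ ≤ B)
    {ν : Fin 2 → ProbabilityMeasure ℝ} (hν : ν ∈ models (c * r ^ 3) B) {i j : Fin 2} (hij : i ≠ j)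
    (hΔ : mean (ν i) - mean (ν j) = Δ) :
    racingRisk B (c * r ^ 3) c ν ≤ ENNReal.ofReal (16 * max 0 (Real.log (3 * (B / c) * r ^ 2)) *
      (c * (c * r ^ 3) ^ 2 / Δ ^ 2 * (1 + 3 * Real.log (Δ / (c * r ^ 2)))) + 3 * c) := by
  have hΔ0 : 0 < Δ := lt_of_lt_of_le (by positivity) hΔr
  have hw : 0 ≤ Real.log (Δ / (c * r ^ 2)) :=
    Real.log_nonneg (by rwa [le_div_iff₀ (by positivity), one_mul])
  have hN0 : 0 < 3 / (2 * Real.exp 1) * r ^ 2 := by positivity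
  rw [racingRisk, budget_eq hc hr, confidence_eq hc hr]
  set N := 3 / (2 * Real.exp 1) * r ^ 2 with hNdef
  obtain ⟨hδ0, -, -⟩ := confidence_bounds hB hc hΔB hN0
  have hfl : ⌊N⌋₊ = 0 := Nat.floor_eq_zero.2 hN
  refine (risk₂_racing_le hc.le (by positivity) hδ0 hν hij hΔ hΔ0.le (k := 1) le_rfl
    (fun h => by omega) (fun n h1 h2 => by omega)).trans (ENNReal.ofReal_le_ofReal ?_)
  rw [hfl]
  simp only [zero_add, Finset.Ico_self, Finset.sum_empty, Nat.cast_one, mul_one, add_zero, one_mul,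
    Finset.Icc_eq_empty_of_lt zero_lt_one]
  have hassoc : Real.exp (-(Δ ^ 2 / (4 * (c * r ^ 3) ^ 2))) =
      Real.exp (-(1 / (4 * (c * r ^ 3) ^ 2) * Δ ^ 2)) := by
    congr 2
    ring
  -- If `r ≤ 1`, that is `σ ≤ c`, the logarithmic factor may vanish, but the error term is at most
  -- `c` and joins the sampling cost `2c`. If `r > 1`, that factor is at least `1` and the main term
  -- absorbs the error.
  rcases le_or_gt r 1 with hr1 | hr1
  · have hlast : Δ * Real.exp (-(Δ ^ 2 / (4 * (c * r ^ 3) ^ 2))) ≤ c := by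
      refine le_of_abs_le (abs_le_of_sq_le_sq ?_ hc.le)
      have h1 := sq_mul_exp_neg_le (by positivity : 0 < 1 / (2 * (c * r ^ 3) ^ 2)) Δ
      calc (Δ * Real.exp (-(Δ ^ 2 / (4 * (c * r ^ 3) ^ 2)))) ^ 2
          = Δ ^ 2 * Real.exp (-(1 / (2 * (c * r ^ 3) ^ 2) * Δ ^ 2)) := by
            rw [mul_pow, ← Real.exp_nat_mul]
            congr 2
            push_cast
            field_simp
            ring
        _ ≤ _ := h1
        _ = 2 / Real.exp 1 * (c ^ 2 * (r ^ 3) ^ 2) := by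
            field_simp
        _ ≤ 1 * (c ^ 2 * 1) := by
            have he : 2 / Real.exp 1 ≤ 1 := by
              rw [div_le_iff₀ (Real.exp_pos 1)]
              linarith [Real.exp_one_gt_d9]
            have hr6 : (r ^ 3) ^ 2 ≤ 1 :=
              pow_le_one₀ (by positivity) (pow_le_one₀ hr.le hr1)
            gcongr
        _ = c ^ 2 := by ring
    have : 0 ≤ 16 * max 0 (Real.log (3 * (B / c) * r ^ 2)) *
      (c * (c * r ^ 3) ^ 2 / Δ ^ 2 * (1 + 3 * Real.log (Δ / (c * r ^ 2)))) := by positivity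
    linarith
  · have hcube : Δ ^ 3 * Real.exp (-(Δ ^ 2 / (4 * (c * r ^ 3) ^ 2))) ≤
        16 * (c * (c * r ^ 3) ^ 2) := by
      rw [hassoc]
      refine cube_mul_exp_neg_le (by positivity) (by positivity) ?_
      calc (3 / (2 * Real.exp 1 * (1 / (4 * (c * r ^ 3) ^ 2)))) ^ 3
          = 64 * (c ^ 6 * r ^ 12) * N ^ 3 := by
            rw [hNdef]
            field_simp
            ring
        _ ≤ 64 * (c ^ 6 * r ^ 12) * 1 := by
            gcongr
            exact pow_le_one₀ hN0.le hN.le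
        _ ≤ 256 * (c ^ 6 * r ^ 12) := by
            have : 0 ≤ c ^ 6 * r ^ 12 := by positivity
            linarith
        _ = (16 * (c * (c * r ^ 3) ^ 2)) ^ 2 := by ring
    have hlast : Δ * Real.exp (-(Δ ^ 2 / (4 * (c * r ^ 3) ^ 2))) ≤
        16 * (c * (c * r ^ 3) ^ 2 / Δ ^ 2) := by
      rw [mul_div_assoc', le_div_iff₀ (by positivity)]
      linarith
    have hlog : 1 ≤ max 0 (Real.log (3 * (B / c) * r ^ 2)) := by
      refine le_max_of_le_right ?_
      rw [Real.le_log_iff_exp_le (by positivity)]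
      have h1 : r ^ 2 ≤ B / c := by
        rw [le_div_iff₀ hc]
        linarith
      have h2 : 1 ≤ r ^ 2 := one_le_pow₀ hr1.le
      have h3 : 1 ≤ B / c * r ^ 2 := one_le_mul_of_one_le_of_one_le (h2.trans h1) h2
      linarith [Real.exp_one_lt_d9]
    have hV : 0 ≤ c * (c * r ^ 3) ^ 2 / Δ ^ 2 := by positivity
    have : 16 * 1 * (c * (c * r ^ 3) ^ 2 / Δ ^ 2 * (1 + 3 * 0)) ≤
        16 * max 0 (Real.log (3 * (B / c) * r ^ 2)) *
        (c * (c * r ^ 3) ^ 2 / Δ ^ 2 * (1 + 3 * Real.log (Δ / (c * r ^ 2)))) := by gcongr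
    linarith

/-- The gap-dependent bound when the budget allows a second epoch. -/
theorem racingRisk_le_of_one_le_budget (hB : 0 < B) (hc : 0 < c) (hr : 0 < r)
    (hN : 1 ≤ 3 / (2 * Real.exp 1) * r ^ 2) (hΔr : c * r ^ 2 ≤ Δ) (hΔB : Δ ≤ B)
    {ν : Fin 2 → ProbabilityMeasure ℝ} (hν : ν ∈ models (c * r ^ 3) B) {i j : Fin 2} (hij : i ≠ j)
    (hΔ : mean (ν i) - mean (ν j) = Δ) :
    racingRisk B (c * r ^ 3) c ν ≤ ENNReal.ofReal (16 * max 0 (Real.log (3 * (B / c) * r ^ 2)) *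
      (c * (c * r ^ 3) ^ 2 / Δ ^ 2 * (1 + 3 * Real.log (Δ / (c * r ^ 2)))) + 3 * c) := by
  have hΔ0 : 0 < Δ := lt_of_lt_of_le (by positivity) hΔr
  have hw : 0 ≤ Real.log (Δ / (c * r ^ 2)) :=
    Real.log_nonneg (by rwa [le_div_iff₀ (by positivity), one_mul])
  have he1 := Real.exp_one_gt_d9
  have he2 := Real.exp_one_lt_d9
  have hκ0 : 0 < 3 / (2 * Real.exp 1) := by positivity
  have hκ1 : 3 / (2 * Real.exp 1) ≤ 0.552 := by
    rw [div_le_iff₀ (by positivity)]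
    linarith
  have hr2 : 1.8 ≤ r ^ 2 := by nlinarith
  have hBr : r ^ 2 ≤ B / c := by
    rw [le_div_iff₀ hc]
    linarith
  have hB0 : 0 < B / c := by positivity
  set L := Real.log (3 * (B / c) * r ^ 2) with hL
  have hL1 : 1 ≤ L := by
    rw [hL, Real.le_log_iff_exp_le (by positivity)]
    nlinarith
  set V := c * (c * r ^ 3) ^ 2 / Δ ^ 2 with hV
  have hV0 : 0 < V := by positivity
  have hmax : max 0 L = L := max_eq_right (by linarith)
  rw [hmax]
  -- Near the critical gap the whole-budget bound is already small enough. Beyond twice it, the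
  -- factor `1 + 3 log(Δ/(c r²))` is at least `3`, which pays for the constants below.
  rcases lt_or_ge Δ (2 * (c * r ^ 2)) with hsmall | hlarge
  · refine (racingRisk_le_budget hc hr hΔ0.le hij hΔ).trans (ENNReal.ofReal_le_ofReal ?_)
    have hVr : c * r ^ 2 / 4 ≤ V := by
      rw [hV, le_div_iff₀ (by positivity)]
      calc c * r ^ 2 / 4 * Δ ^ 2 ≤ c * r ^ 2 / 4 * (2 * (c * r ^ 2)) ^ 2 := by gcongr
        _ = c * (c * r ^ 3) ^ 2 := by ring
    have h1 : 16 * 1 * (c * r ^ 2 / 4 * (1 + 3 * 0)) ≤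
        16 * L * (V * (1 + 3 * Real.log (Δ / (c * r ^ 2)))) := by gcongr
    linarith
  have hlogw : 2 / 3 ≤ Real.log (Δ / (c * r ^ 2)) := by
    have h2 : Real.log 2 ≤ Real.log (Δ / (c * r ^ 2)) := by
      gcongr
      rwa [le_div_iff₀ (by positivity)]
    linarith [Real.log_two_gt_d9]
  rw [racingRisk, budget_eq hc hr, confidence_eq hc hr]
  set N := 3 / (2 * Real.exp 1) * r ^ 2 with hNdef
  have hN0 : 0 < N := by linarith
  obtain ⟨hδ0, hδB, hδN⟩ := confidence_bounds hB hc hΔB hN0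
  set δ := c / (B + 2 * c * N) with hδ
  have hm : (⌊N⌋₊ : ℝ) ≤ N := Nat.floor_le hN0.le
  have hmlt : N < (⌊N⌋₊ + 1 : ℕ) := by exact_mod_cast Nat.lt_floor_add_one N
  set M := Real.log (2 * N / δ) with hM
  have hM0 : 0 < M := Real.log_pos (by
    rw [lt_div_iff₀ hδ0]
    nlinarith)
  have hML : M ≤ L := by
    rw [hM, hL]
    gcongr
    have hNr : N ≤ 0.552 * r ^ 2 := by
      rw [hNdef]
      gcongr
    have h1 : 2 * N / δ = 2 * N * (B / c + 2 * N) := by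
      rw [hδ]
      field_simp
    rw [h1]
    calc 2 * N * (B / c + 2 * N)
        ≤ 2 * (0.552 * r ^ 2) * (B / c + 2 * (0.552 * (B / c))) := by
          gcongr
          exact hNr.trans (by gcongr)
      _ ≤ 3 * (B / c) * r ^ 2 := by
          have : 0 ≤ B / c * r ^ 2 := by positivity
          nlinarith
  -- This solves `2 e_n ≤ Δ` for `n`, with the logarithm `log(2n/δ)` replaced by its bound `M` for
  -- `n ≤ N`.
  set x := 16 * (c * r ^ 3) ^ 2 * M / Δ ^ 2 with hx
  have hx0 : 0 < x := by positivity
  have hk : 1 ≤ ⌈x⌉₊ := Nat.one_le_ceil_iff.2 hx0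
  refine (risk₂_racing_le hc.le (by positivity) hδ0 hν hij hΔ hΔ0.le hk
    (fun _ => by nlinarith) (fun n h1 h2 => ?_)).trans (ENNReal.ofReal_le_ofReal ?_)
  · have hn1 : (1 : ℝ) ≤ n := by exact_mod_cast hk.trans h1
    have hnN : (n : ℝ) ≤ N := le_trans (by exact_mod_cast h2) hm
    have hxn : x ≤ n := Nat.ceil_le.1 h1
    rw [hx, div_le_iff₀ (by positivity)] at hxn
    have hlog : Real.log (2 * n / δ) ≤ M := by
      rw [hM]
      gcongr
    have hle : confWidth (c * r ^ 3) δ n ≤ Δ / 2 := by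
      rw [confWidth]
      refine Real.sqrt_le_iff.2 ⟨by positivity, ?_⟩
      have hlog' : 4 * (c * r ^ 3) ^ 2 * Real.log (2 * n / δ) ≤ 4 * (c * r ^ 3) ^ 2 * M := by gcongr
      rw [mul_right_comm, ← div_eq_mul_inv, div_le_iff₀ (by linarith)]
      linarith
    linarith
  have hsum1 : c * ∑ n ∈ Finset.Ico ⌈x⌉₊ (⌊N⌋₊ + 1), δ / (2 * n) ≤ c / 4 := by
    have h1 : ∑ n ∈ Finset.Ico ⌈x⌉₊ (⌊N⌋₊ + 1), δ / (2 * n) ≤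
        ∑ n ∈ Finset.Ico ⌈x⌉₊ (⌊N⌋₊ + 1), δ / 2 := by
      refine Finset.sum_le_sum fun n hn => ?_
      have hn1 : (1 : ℝ) ≤ n := by exact_mod_cast hk.trans (Finset.mem_Ico.1 hn).1
      gcongr
      linarith
    have h2 : ∑ n ∈ Finset.Ico ⌈x⌉₊ (⌊N⌋₊ + 1), δ / 2 ≤ N * (δ / 2) := by
      rw [Finset.sum_const, Nat.card_Ico, nsmul_eq_mul]
      gcongr
      refine le_trans ?_ hm
      exact_mod_cast (by omega : ⌊N⌋₊ + 1 - ⌈x⌉₊ ≤ ⌊N⌋₊)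
    have h3 : ∑ n ∈ Finset.Ico ⌈x⌉₊ (⌊N⌋₊ + 1), δ / (2 * n) ≤ 1 / 4 := by linarith
    linarith [mul_le_mul_of_nonneg_left h3 hc.le]
  have hsum2 : Δ * ∑ n ∈ Finset.Icc 1 ⌊N⌋₊,
      δ / (2 * n) * Real.exp (-(n * (Δ ^ 2 / (4 * (c * r ^ 3) ^ 2)))) ≤ 4 * V := by
    refine (sum_eliminated_le hc.le hδB _ (by positivity)).trans_eq ?_
    rw [hV]
    field_simp
  have hlast : Δ * Real.exp (-((⌊N⌋₊ + 1 : ℕ) * (Δ ^ 2 / (4 * (c * r ^ 3) ^ 2)))) ≤ 8 * V := by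
    have hexp : Real.exp (-((⌊N⌋₊ + 1 : ℕ) * (Δ ^ 2 / (4 * (c * r ^ 3) ^ 2)))) ≤
        Real.exp (-(N * (Δ ^ 2 / (4 * (c * r ^ 3) ^ 2)))) := by
      gcongr
    have hcube : Δ ^ 3 * Real.exp (-(N / (4 * (c * r ^ 3) ^ 2) * Δ ^ 2)) ≤
        8 * (c * (c * r ^ 3) ^ 2) := by
      refine cube_mul_exp_neg_le (by positivity) (by positivity) (le_of_eq ?_)
      rw [hNdef]
      field_simp
      ring
    refine (mul_le_mul_of_nonneg_left hexp hΔ0.le).trans ?_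
    rw [hV, mul_div_assoc' 8, le_div_iff₀ (by positivity)]
    calc Δ * Real.exp (-(N * (Δ ^ 2 / (4 * (c * r ^ 3) ^ 2)))) * Δ ^ 2
        = Δ ^ 3 * Real.exp (-(N / (4 * (c * r ^ 3) ^ 2) * Δ ^ 2)) := by
          rw [mul_div_assoc', div_mul_eq_mul_div]
          ring
      _ ≤ 8 * (c * (c * r ^ 3) ^ 2) := hcube
  have hk2 : c * (⌈x⌉₊ : ℝ) ≤ 16 * V * M + c := by
    have h1 := mul_le_mul_of_nonneg_left (Nat.ceil_lt_add_one hx0.le).le hc.le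
    have h2 : c * x = 16 * V * M := by
      rw [hx, hV]
      ring
    linarith
  have hVM : V * M ≤ V * L := by gcongr
  have hVL : V * 1 ≤ V * L := by gcongr
  -- The left side is `48VL`; the terms to cover are `32VL` from the epochs, `4V` from eliminations
  -- and `8V` from the final comparison.
  have hfin : 16 * L * (V * (1 + 3 * (2 / 3))) ≤
      16 * L * (V * (1 + 3 * Real.log (Δ / (c * r ^ 2)))) := by gcongr
  rw [mul_add Δ]
  linarith

end policy

/-! ### Removing the fractional powers -/

section parametrization

variable {c r : ℝ}

/-- In terms of `c` and `r` the budget, the critical gap and the argument of the logarithm contain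
only integer powers. -/
theorem exists_eq_mul_cube {σ : ℝ} (hc : 0 < c) (hσ : 0 < σ) : ∃ r > 0, σ = c * r ^ 3 := by
  refine ⟨(σ / c) ^ (1 / 3 : ℝ), by positivity, ?_⟩
  rw [← Real.rpow_natCast, ← Real.rpow_mul (by positivity)]
  norm_num
  field_simp

theorem critical_gap_eq (hc : 0 < c) (hr : 0 < r) :
    ((c * r ^ 3) ^ 2 * c) ^ (1 / 3 : ℝ) = c * r ^ 2 := by
  rw [show (c * r ^ 3) ^ 2 * c = (c * r ^ 2) ^ 3 by ring, ← Real.rpow_natCast,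
    ← Real.rpow_mul (by positivity)]
  norm_num

theorem log_argument_eq (B : ℝ) (hc : 0 < c) (hr : 0 < r) :
    3 * B * (c * r ^ 3) ^ (2 / 3 : ℝ) / c ^ (5 / 3 : ℝ) = 3 * (B / c) * r ^ 2 := by
  have h1 : (r ^ 3) ^ (2 / 3 : ℝ) = r ^ 2 := by
    rw [← Real.rpow_natCast, ← Real.rpow_mul hr.le, ← Real.rpow_natCast]
    norm_num
  have h2 : c ^ (5 / 3 : ℝ) = c ^ (2 / 3 : ℝ) * c := by
    rw [← Real.rpow_add_one hc.ne']
    norm_num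
  rw [Real.mul_rpow hc.le (by positivity), h1, h2]
  have := Real.rpow_pos_of_pos hc (2 / 3)
  field_simp

theorem hard₂_of_le {Δ : ℝ} (hc : 0 < c) (hr : 0 < r) (hΔ : c * r ^ 2 ≤ Δ) :
    hard₂ (c * r ^ 3) c Δ =
      c * (c * r ^ 3) ^ 2 / Δ ^ 2 * (1 + 3 * Real.log (Δ / (c * r ^ 2))) / 4 := by
  have hcr : 0 < c * r ^ 2 := by positivity
  have hΔ0 : 0 < Δ := lt_of_lt_of_le hcr hΔ
  rw [hard₂, critical_gap_eq hc hr, if_pos hΔ,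
    show Real.exp 1 * Δ ^ 3 / ((c * r ^ 3) ^ 2 * c) = Real.exp 1 * (Δ / (c * r ^ 2)) ^ 3 by
      field_simp,
    Real.log_mul (Real.exp_pos 1).ne' (by positivity), Real.log_exp, Real.log_pow]
  push_cast
  field_simp

theorem hard₂Star_eq (hc : 0 < c) (hr : 0 < r) :
    hard₂Star (c * r ^ 3) c = 3 / 8 * (c * r ^ 2 * Real.exp (-(1 / 3))) := by
  rw [hard₂Star, Real.div_rpow (by positivity) (Real.exp_pos 1).le, critical_gap_eq hc hr,
    ← Real.exp_mul, one_mul, Real.exp_neg, ← div_eq_mul_inv]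

end parametrization

/-! ### Explicit worst-case bounds -/

theorem exists_arms (ν : Fin 2 → ProbabilityMeasure ℝ) :
    ∃ i j : Fin 2, i ≠ j ∧ mean (ν i) - mean (ν j) = |mean (ν 0) - mean (ν 1)| := by
  rcases le_total (mean (ν 1)) (mean (ν 0)) with h | h
  · exact ⟨0, 1, by decide, (abs_of_nonneg (sub_nonneg.2 h)).symm⟩
  · exact ⟨1, 0, by decide, by rw [abs_of_nonpos (sub_nonpos.2 h), neg_sub]⟩

theorem mean_sub_mean_le {σ B : ℝ} {ν : Fin 2 → ProbabilityMeasure ℝ} (hν : ν ∈ models σ B)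
    (i j : Fin 2) : mean (ν i) - mean (ν j) ≤ B := by
  linarith [(hν i).2.2, (hν j).2.1]

theorem worstRisk_modelsGap_le_of_le {B σ c Δ : ℝ} (hB : 0 < B) (hσ : 0 < σ) (hc : 0 < c)
    (hΔ : (σ ^ 2 * c) ^ (1 / 3 : ℝ) ≤ Δ) :
    worstRisk B σ c (modelsGap σ B Δ) ≤ ENNReal.ofReal
      (64 * max 0 (Real.log (3 * B * σ ^ (2 / 3 : ℝ) / c ^ (5 / 3 : ℝ))) * hard₂ σ c Δ +
        3 * c) := by
  obtain ⟨r, hr, rfl⟩ := exists_eq_mul_cube hc hσ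
  rw [critical_gap_eq hc hr] at hΔ
  refine iSup₂_le fun ν hν => ?_
  obtain ⟨i, j, hij, hΔij⟩ := exists_arms ν
  rw [hν.2] at hΔij
  have hΔB : Δ ≤ B := hΔij ▸ mean_sub_mean_le hν.1 i j
  rw [log_argument_eq B hc hr, hard₂_of_le hc hr hΔ]
  refine le_of_le_of_eq (b := ENNReal.ofReal (16 * max 0 (Real.log (3 * (B / c) * r ^ 2)) *
    (c * (c * r ^ 3) ^ 2 / Δ ^ 2 * (1 + 3 * Real.log (Δ / (c * r ^ 2)))) + 3 * c)) ?_
    (by congr 1; ring)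
  rcases lt_or_ge (3 / (2 * Real.exp 1) * r ^ 2) 1 with hN | hN
  · exact racingRisk_le_of_budget_lt_one hB hc hr hN hΔ hΔB hν.1 hij hΔij
  · exact racingRisk_le_of_one_le_budget hB hc hr hN hΔ hΔB hν.1 hij hΔij

theorem worstRisk_modelsGap_le_of_lt {B σ c Δ : ℝ} (hσ : 0 < σ) (hc : 0 < c)
    (hΔ0 : 0 ≤ Δ) (hΔ : Δ < (σ ^ 2 * c) ^ (1 / 3 : ℝ)) :
    worstRisk B σ c (modelsGap σ B Δ) ≤ ENNReal.ofReal
      (4 * hard₂ σ c Δ + 2 * (σ ^ 2 * c) ^ (1 / 3 : ℝ) + 3 * c) := by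
  rw [hard₂, if_neg hΔ.not_ge]
  obtain ⟨r, hr, rfl⟩ := exists_eq_mul_cube hc hσ
  rw [critical_gap_eq hc hr]
  refine iSup₂_le fun ν hν => ?_
  obtain ⟨i, j, hij, hΔij⟩ := exists_arms ν
  rw [hν.2] at hΔij
  refine (racingRisk_le_budget hc hr hΔ0 hij hΔij).trans (ENNReal.ofReal_le_ofReal ?_)
  linarith

theorem worstRisk_models_le {B σ c : ℝ} (hB : 0 < B) (hσ : 0 < σ) (hc : 0 < c) :
    worstRisk B σ c (models σ B) ≤ ENNReal.ofReal (9 * hard₂Star σ c + 3 * c) := by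
  obtain ⟨r, hr, rfl⟩ := exists_eq_mul_cube hc hσ
  refine iSup₂_le fun ν hν => ?_
  obtain ⟨i, j, hij, hΔij⟩ := exists_arms ν
  rw [hard₂Star_eq hc hr]
  exact (racingRisk_le_minimax hB hc hr (hΔij ▸ abs_nonneg _) (mean_sub_mean_le hν i j) hν hij
    rfl).trans_eq (by congr 1; ring)

/-! ### Comparison of logarithms and rates for small costs -/

theorem worstRisk_modelsGap_eq_zero {B σ c Δ : ℝ} (hΔ : B < Δ) :
    worstRisk B σ c (modelsGap σ B Δ) = 0 := by
  have hempty : modelsGap σ B Δ = ∅ := by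
    refine Set.eq_empty_of_forall_notMem fun ν hν => ?_
    obtain ⟨i, j, -, hΔij⟩ := exists_arms ν
    rw [hν.2] at hΔij
    linarith [mean_sub_mean_le hν.1 i j]
  simp [worstRisk, hempty]

/-- The gap-dependent hardness is at least its leading factor. -/
theorem le_hard₂ {σ c Δ : ℝ} (hσ : 0 < σ) (hc : 0 < c) (hΔ : (σ ^ 2 * c) ^ (1 / 3 : ℝ) ≤ Δ) :
    σ ^ 2 * c / (4 * Δ ^ 2) ≤ hard₂ σ c Δ := by
  obtain ⟨r, hr, rfl⟩ := exists_eq_mul_cube hc hσ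
  rw [critical_gap_eq hc hr] at hΔ
  rw [hard₂_of_le hc hr hΔ]
  have hw : 0 ≤ Real.log (Δ / (c * r ^ 2)) :=
    Real.log_nonneg (by rwa [le_div_iff₀ (by positivity), one_mul])
  have hV : 0 ≤ c * (c * r ^ 3) ^ 2 / Δ ^ 2 := by positivity
  calc (c * r ^ 3) ^ 2 * c / (4 * Δ ^ 2)
      = c * (c * r ^ 3) ^ 2 / Δ ^ 2 * (1 + 3 * 0) / 4 := by
        rw [mul_zero, add_zero, mul_one, div_div, mul_comm c ((c * r ^ 3) ^ 2),
          mul_comm 4]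
    _ ≤ _ := by gcongr

/-- Since `σ^(2/3) · σ² = (σ^(4/3))²`, twice the right-hand logarithm is the left-hand one plus the
one with `σ²`, which the hypothesis makes nonnegative. -/
theorem max_log_le_two_mul_log {B σ c : ℝ} (hB : 0 < B) (hσ : 0 < σ) (hc : 0 < c)
    (h : c ^ (5 / 3 : ℝ) ≤ 3 * B * min (σ ^ (4 / 3 : ℝ)) (σ ^ 2)) :
    max 0 (Real.log (3 * B * σ ^ (2 / 3 : ℝ) / c ^ (5 / 3 : ℝ))) ≤
      2 * Real.log (3 * B * σ ^ (4 / 3 : ℝ) / c ^ (5 / 3 : ℝ)) := by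
  have hc' := Real.rpow_pos_of_pos hc (5 / 3)
  have h1 := Real.rpow_pos_of_pos hσ (2 / 3)
  have h2 := Real.rpow_pos_of_pos hσ (4 / 3)
  have hnonneg {y : ℝ} (hy : min (σ ^ (4 / 3 : ℝ)) (σ ^ 2) ≤ y) :
      0 ≤ Real.log (3 * B * y / c ^ (5 / 3 : ℝ)) := by
    refine Real.log_nonneg ?_
    rw [le_div_iff₀ hc', one_mul]
    exact h.trans (by gcongr)
  have h3 := hnonneg (min_le_left _ _)
  have h4 := hnonneg (min_le_right _ _)
  have hpow : σ ^ (2 / 3 : ℝ) * σ ^ 2 = (σ ^ (4 / 3 : ℝ)) ^ 2 := by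
    rw [← Real.rpow_natCast, ← Real.rpow_natCast, ← Real.rpow_mul hσ.le, ← Real.rpow_add hσ]
    norm_num
  have hsum : Real.log (3 * B * σ ^ (2 / 3 : ℝ) / c ^ (5 / 3 : ℝ)) +
      Real.log (3 * B * σ ^ 2 / c ^ (5 / 3 : ℝ)) =
      2 * Real.log (3 * B * σ ^ (4 / 3 : ℝ) / c ^ (5 / 3 : ℝ)) := by
    have hsq := Real.log_pow (3 * B * σ ^ (4 / 3 : ℝ) / c ^ (5 / 3 : ℝ)) 2
    rw [Nat.cast_two] at hsq
    rw [← Real.log_mul (by positivity) (by positivity), ← hsq]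
    congr 1
    rw [div_mul_div_comm, div_pow, mul_pow, ← hpow]
    ring
  exact max_le (by linarith) (by linarith)

theorem max_log_le {B σ c : ℝ} (hB : 0 < B) (hσ : 0 < σ) (hc : 0 < c)
    (hlog : 1 ≤ Real.log (1 / c)) :
    max 0 (Real.log (3 * B * σ ^ (2 / 3 : ℝ) / c ^ (5 / 3 : ℝ))) ≤
      (|Real.log (3 * B * σ ^ (2 / 3 : ℝ))| + 5 / 3) * Real.log (1 / c) := by
  have h1 := Real.rpow_pos_of_pos hσ (2 / 3)
  have habs := abs_nonneg (Real.log (3 * B * σ ^ (2 / 3 : ℝ)))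
  refine max_le (by positivity) ?_
  rw [Real.log_div (by positivity) (Real.rpow_pos_of_pos hc _).ne', Real.log_rpow hc]
  rw [one_div, Real.log_inv] at hlog ⊢
  nlinarith [le_abs_self (Real.log (3 * B * σ ^ (2 / 3 : ℝ)))]

theorem le_rpow_one_third {c : ℝ} (hc : 0 < c) (hc1 : c ≤ 1) : c ≤ c ^ (1 / 3 : ℝ) := by
  simpa using Real.rpow_le_rpow_of_exponent_ge hc hc1 (by norm_num : (1 / 3 : ℝ) ≤ 1)

theorem worstRisk_modelsGap_rate_of_le {B σ c Δ : ℝ} (hB : 0 < B) (hσ : 0 < σ) (hc : 0 < c)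
    (hlog : 1 ≤ Real.log (1 / c)) (hΔ : (σ ^ 2 * c) ^ (1 / 3 : ℝ) ≤ Δ) :
    worstRisk B σ c (modelsGap σ B Δ) ≤ ENNReal.ofReal
      ((64 * (|Real.log (3 * B * σ ^ (2 / 3 : ℝ))| + 5 / 3) + 12 * B ^ 2 / σ ^ 2) *
        (Real.log (1 / c) * hard₂ σ c Δ)) := by
  -- The term `3c` is absorbed through `hard₂ ≥ σ²c/(4Δ²) ≥ σ²c/(4B²)`, which needs `Δ ≤ B`; larger
  -- gaps have no models.
  rcases lt_or_ge B Δ with hBΔ | hΔB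
  · rw [worstRisk_modelsGap_eq_zero hBΔ]
    exact zero_le
  have hΔ0 : 0 < Δ := lt_of_lt_of_le (by positivity) hΔ
  refine (worstRisk_modelsGap_le_of_le hB hσ hc hΔ).trans (ENNReal.ofReal_le_ofReal ?_)
  have hh := le_hard₂ hσ hc hΔ
  have hh0 : 0 < hard₂ σ c Δ := lt_of_lt_of_le (by positivity) hh
  have h1 := mul_le_mul_of_nonneg_right (max_log_le hB hσ hc hlog) hh0.le
  have h2 : 3 * c ≤ 12 * B ^ 2 / σ ^ 2 * (1 * hard₂ σ c Δ) := by
    calc 3 * c = 12 * B ^ 2 / σ ^ 2 * (1 * (σ ^ 2 * c / (4 * B ^ 2))) := by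
          field_simp
          norm_num
      _ ≤ 12 * B ^ 2 / σ ^ 2 * (1 * (σ ^ 2 * c / (4 * Δ ^ 2))) := by gcongr
      _ ≤ 12 * B ^ 2 / σ ^ 2 * (1 * hard₂ σ c Δ) := by gcongr
  have h3 : 12 * B ^ 2 / σ ^ 2 * (1 * hard₂ σ c Δ) ≤
      12 * B ^ 2 / σ ^ 2 * (Real.log (1 / c) * hard₂ σ c Δ) := by gcongr
  linarith

theorem worstRisk_modelsGap_rate_of_lt {B σ c Δ : ℝ} (hσ : 0 < σ) (hc : 0 < c)
    (hc1 : c ≤ 1) (hΔ0 : 0 ≤ Δ) (hΔ : Δ < (σ ^ 2 * c) ^ (1 / 3 : ℝ)) :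
    worstRisk B σ c (modelsGap σ B Δ) ≤ ENNReal.ofReal
      ((2 * (σ ^ 2) ^ (1 / 3 : ℝ) + 7) * (hard₂ σ c Δ + c ^ (1 / 3 : ℝ))) := by
  refine (worstRisk_modelsGap_le_of_lt hσ hc hΔ0 hΔ).trans (ENNReal.ofReal_le_ofReal ?_)
  rw [hard₂, if_neg hΔ.not_ge, Real.mul_rpow (sq_nonneg σ) hc.le]
  have h1 := Real.rpow_nonneg (sq_nonneg σ) (1 / 3)
  have h2 := Real.rpow_nonneg hc.le (1 / 3)
  have h3 := le_rpow_one_third hc hc1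
  have h4 := mul_nonneg h1 hΔ0
  linarith

theorem worstRisk_models_rate {B σ c : ℝ} (hB : 0 < B) (hσ : 0 < σ) (hc : 0 < c) (hc1 : c ≤ 1) :
    worstRisk B σ c (models σ B) ≤ ENNReal.ofReal
      ((9 + 8 / (σ ^ 2 / Real.exp 1) ^ (1 / 3 : ℝ)) * hard₂Star σ c) := by
  refine (worstRisk_models_le hB hσ hc).trans (ENNReal.ofReal_le_ofReal ?_)
  have hs : 0 < (σ ^ 2 / Real.exp 1) ^ (1 / 3 : ℝ) := by positivity
  have hstar : hard₂Star σ c = 3 / 8 * ((σ ^ 2 / Real.exp 1) ^ (1 / 3 : ℝ) * c ^ (1 / 3 : ℝ)) := by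
    rw [hard₂Star, mul_div_right_comm, Real.mul_rpow (by positivity) hc.le]
  have h3 := le_rpow_one_third hc hc1
  -- The second constant is chosen so that its product with `hard₂Star` dominates `3c` for `c ≤ 1`.
  have h4 : 8 / (σ ^ 2 / Real.exp 1) ^ (1 / 3 : ℝ) * hard₂Star σ c = 3 * c ^ (1 / 3 : ℝ) := by
    rw [hstar]
    field_simp
  rw [add_mul, h4]
  linarith

end TwoArmRacing

theorem corollary4 (B σ : ℝ) (hB : 0 < B) (hσ : 0 < σ) :
    -- the explicit bounds, for every cost `c > 0`
    (∀ c : ℝ, 0 < c →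
      (∀ Δ : ℝ, (σ ^ 2 * c) ^ (1 / 3 : ℝ) ≤ Δ →
        TwoArmRacing.worstRisk B σ c (TwoArmRacing.modelsGap σ B Δ) ≤
          ENNReal.ofReal (128 * max 0 (Real.log (3 * B * σ ^ (2 / 3 : ℝ) / c ^ (5 / 3 : ℝ))) *
            TwoArmRacing.hard₂ σ c Δ + 3 * c) ∧
        (c ^ (5 / 3 : ℝ) ≤ 3 * B * min (σ ^ (4 / 3 : ℝ)) (σ ^ 2) →
          TwoArmRacing.worstRisk B σ c (TwoArmRacing.modelsGap σ B Δ) ≤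
            ENNReal.ofReal (128 * Real.log (3 * B * σ ^ (4 / 3 : ℝ) / c ^ (5 / 3 : ℝ)) *
              TwoArmRacing.hard₂ σ c Δ + 3 * c))) ∧
      (∀ Δ : ℝ, 0 ≤ Δ → Δ < (σ ^ 2 * c) ^ (1 / 3 : ℝ) →
        TwoArmRacing.worstRisk B σ c (TwoArmRacing.modelsGap σ B Δ) ≤
          ENNReal.ofReal (4 * TwoArmRacing.hard₂ σ c Δ + 2 * (σ ^ 2 * c) ^ (1 / 3 : ℝ) + 3 * c)) ∧
      TwoArmRacing.worstRisk B σ c (TwoArmRacing.models σ B) ≤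
        ENNReal.ofReal (9 * TwoArmRacing.hard₂Star σ c + 3 * c)) ∧
    -- the rates as `c → 0`, uniformly in the gap
    (∃ C > 0, ∃ c₀ > 0, ∀ c : ℝ, 0 < c → c ≤ c₀ →
      (∀ Δ : ℝ, (σ ^ 2 * c) ^ (1 / 3 : ℝ) ≤ Δ →
        TwoArmRacing.worstRisk B σ c (TwoArmRacing.modelsGap σ B Δ) ≤
          ENNReal.ofReal (C * (Real.log (1 / c) * TwoArmRacing.hard₂ σ c Δ))) ∧
      (∀ Δ : ℝ, 0 ≤ Δ → Δ < (σ ^ 2 * c) ^ (1 / 3 : ℝ) →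
        TwoArmRacing.worstRisk B σ c (TwoArmRacing.modelsGap σ B Δ) ≤
          ENNReal.ofReal (C * (TwoArmRacing.hard₂ σ c Δ + c ^ (1 / 3 : ℝ)))) ∧
      TwoArmRacing.worstRisk B σ c (TwoArmRacing.models σ B) ≤
        ENNReal.ofReal (C * TwoArmRacing.hard₂Star σ c)) := by
  refine ⟨fun c hc => ⟨fun Δ hΔ => ?_, fun Δ hΔ0 hΔ =>
    TwoArmRacing.worstRisk_modelsGap_le_of_lt hσ hc hΔ0 hΔ,
    TwoArmRacing.worstRisk_models_le hB hσ hc⟩, ?_⟩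
  · have hle := TwoArmRacing.worstRisk_modelsGap_le_of_le hB hσ hc hΔ
    have hh : 0 ≤ TwoArmRacing.hard₂ σ c Δ :=
      le_trans (by positivity) (TwoArmRacing.le_hard₂ hσ hc hΔ)
    refine ⟨hle.trans (ENNReal.ofReal_le_ofReal ?_),
      fun hcB => hle.trans (ENNReal.ofReal_le_ofReal ?_)⟩
    · gcongr
      norm_num
    · have h := mul_le_mul_of_nonneg_right
        (TwoArmRacing.max_log_le_two_mul_log hB hσ hc hcB) hh
      linarith
  · set C₁ := 64 * (|Real.log (3 * B * σ ^ (2 / 3 : ℝ))| + 5 / 3) + 12 * B ^ 2 / σ ^ 2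
    set C₂ := 2 * (σ ^ 2) ^ (1 / 3 : ℝ) + 7
    set C₃ := 9 + 8 / (σ ^ 2 / Real.exp 1) ^ (1 / 3 : ℝ)
    have hC₁ : 0 < C₁ := by positivity
    have hC₂ : 0 < C₂ := by positivity
    have hC₃ : 0 < C₃ := by positivity
    -- The threshold `exp(-1)` gives `log(1/c) ≥ 1`, so that constants can be absorbed into the
    -- logarithm.
    refine ⟨C₁ + C₂ + C₃, by positivity, Real.exp (-1), Real.exp_pos _, fun c hc hc₀ => ?_⟩
    have hc1 : c ≤ 1 := hc₀.trans (Real.exp_le_one_iff.2 (by norm_num))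
    have hlog : 1 ≤ Real.log (1 / c) := by
      rw [Real.le_log_iff_exp_le (by positivity), one_div, le_inv_comm₀ (Real.exp_pos 1) hc,
        ← Real.exp_neg]
      exact hc₀
    refine ⟨fun Δ hΔ => ?_, fun Δ hΔ0 hΔ => ?_, ?_⟩
    · have hh : 0 ≤ TwoArmRacing.hard₂ σ c Δ :=
        le_trans (by positivity) (TwoArmRacing.le_hard₂ hσ hc hΔ)
      refine (TwoArmRacing.worstRisk_modelsGap_rate_of_le hB hσ hc hlog hΔ).trans
        (ENNReal.ofReal_le_ofReal ?_)
      exact mul_le_mul_of_nonneg_right (by linarith : C₁ ≤ C₁ + C₂ + C₃) (by positivity)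
    · refine (TwoArmRacing.worstRisk_modelsGap_rate_of_lt hσ hc hc1 hΔ0 hΔ).trans
        (ENNReal.ofReal_le_ofReal ?_)
      refine mul_le_mul_of_nonneg_right (by linarith : C₂ ≤ C₁ + C₂ + C₃) ?_
      rw [TwoArmRacing.hard₂, if_neg hΔ.not_ge]
      positivity
    · refine (TwoArmRacing.worstRisk_models_rate hB hσ hc hc1).trans
        (ENNReal.ofReal_le_ofReal ?_)
      refine mul_le_mul_of_nonneg_right (by linarith : C₃ ≤ C₁ + C₂ + C₃) ?_
      rw [TwoArmRacing.hard₂Star]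
      positivity
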